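/- Let $G$ be a finite simple graph with linearly ordered vertex set $V(G)$ and edge set $E(G)$. Let $\mathcal C^\bullet(G)$ be the real exterior algebra on generators $x_i^*$ ($i\in V(G)$) and $x_{i,j}^*$ ($\{i,j\}\in E(G)$, $i<j$), all of degree $1$, with the differential $Q$ given by the odd derivation such that $Q(x_i^*)=0$ and $Q(x_{i,j}^*)=x_i^*x_j^*$ (this is the Chevalley–Eilenberg complex of the Dani–Mainkar Lie algebra of $G$). Let $\mathcal C^\bullet(G,V(G))\subseteq\mathcal C^\bullet(G)$ be the subcomplex spanned by the monomials $x_{i_1}^*\cdots x_{i_p}^*x_{r_1,s_1}^*\cdots x_{r_q,s_q}^*$ with $\{i_1,\dots,i_p,r_1,s_1,\dots,r_q,s_q\}=V(G)$. The *essential cohomology* of $G$ is the cohomology of this subcomplex; let $\beta_k(G)$ be its dimension over $\mathbb R$ in degree $k$. Let $S_n$ be the star graph with vertices $1,\dots,n+1$ and edges $\{1,2\},\dots,\{1,n+1\}$. Then for all integers $k>n>0$, $$\beta_k(S_n)=\binom{2n-k}{\lfloor (2n-k)/2\rfloor}\binom{n}{2n-k}+\binom{2n-k+1}{\lfloor (2n-k+1)/2\rfloor}\binom{n}{2n-k+1},$$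 where $\binom ab=0$ unless $0\le b\le a$. -/

import Mathlib

open scoped BigOperators

namespace DaniMainkar

/-- Edges `{i, j}` of `G`, recorded once each, as ordered pairs with `i < j`. -/
abbrev Edge {V : Type*} [LinearOrder V] (G : SimpleGraph V) : Type _ :=
  {p : V × V // p.1 < p.2 ∧ G.Adj p.1 p.2}

/-- Labels of the generators of the Chevalley–Eilenberg algebra: a vertex `i` labels `x_i^*`,
an edge `{i, j}` with `i < j` labels `x_{i,j}^*`. -/
abbrev Gen {V : Type*} [LinearOrder V] (G : SimpleGraph V) : Type _ := V ⊕ Edge G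

/-- The dual of the Dani–Mainkar Lie algebra of `G`: the real vector space with basis
`x_i^*` (vertices) and `x_{i,j}^*` (edges). -/
abbrev DualSpace {V : Type*} [LinearOrder V] (G : SimpleGraph V) : Type _ := Gen G →₀ ℝ

/-- The underlying algebra of the Cartan–Chevalley–Eilenberg complex of the Dani–Mainkar Lie
algebra of `G`: skew-commuting real polynomials in the `x_i^*` and `x_{i,j}^*`. -/
abbrev CE {V : Type*} [LinearOrder V] (G : SimpleGraph V) : Type _ :=
  ExteriorAlgebra ℝ (DualSpace G)

/-- The generator `x_i^*` or `x_{i,j}^*` with label `a`. -/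
noncomputable def x {V : Type*} [LinearOrder V] {G : SimpleGraph V} (a : Gen G) : CE G :=
  ExteriorAlgebra.ι ℝ (Finsupp.single a 1)

/-- The odd derivation `∂/∂x_{i,j}^*` (left contraction with the coordinate functional). -/
noncomputable def partialEdge {V : Type*} [LinearOrder V] {G : SimpleGraph V} (e : Edge G) :
    CE G →ₗ[ℝ] CE G :=
  CliffordAlgebra.contractLeft
    (Q := (0 : QuadraticForm ℝ (DualSpace G))) (Finsupp.lapply (Sum.inr e))

/-- The differential `Q = ∑_{i<j, {i,j} ∈ E(G)} x_i^* x_j^* ∂/∂x_{i,j}^*`. By `Q_one`, `Q_vertex`,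
`Q_edge` and `Q_x_mul` below, this is the odd derivation with `Q(x_i^*) = 0` and
`Q(x_{i,j}^*) = x_i^* x_j^*` for every edge `{i, j}` with `i < j`. -/
noncomputable def Q {V : Type*} [LinearOrder V] [Fintype V] (G : SimpleGraph V)
    [DecidableRel G.Adj] : CE G →ₗ[ℝ] CE G :=
  ∑ e : Edge G,
    (LinearMap.mulLeft ℝ (x (G := G) (Sum.inl e.1.1) * x (Sum.inl e.1.2))).comp (partialEdge e)

/-- The vertices that occur in a generator: `i` for `x_i^*`, and `i, j` for `x_{i,j}^*`. -/
def Gen.vertices {V : Type*} [LinearOrder V] {G : SimpleGraph V} : Gen G → Set V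
  | Sum.inl i => {i}
  | Sum.inr e => {e.1.1, e.1.2}

/-- The vertices that occur in a monomial, given as a list of generators. -/
def monomialVertices {V : Type*} [LinearOrder V] {G : SimpleGraph V} (l : List (Gen G)) : Set V :=
  {v | ∃ a ∈ l, v ∈ Gen.vertices a}

/-- The degree `k` component of the subcomplex of the Cartan–Chevalley–Eilenberg complex labelled
by `S ⊆ V(G)`: it is spanned by the monomials of degree `k` whose set of vertices is exactly `S`.
By convention it is zero if `S = ∅`. -/
noncomputable def cochains {V : Type*} [LinearOrder V] (G : SimpleGraph V) (S : Set V) (k : ℕ) :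
    Submodule ℝ (CE G) :=
  Submodule.span ℝ {ω | ∃ l : List (Gen G),
    l.length = k ∧ S.Nonempty ∧ monomialVertices l = S ∧ (l.map x).prod = ω}

/-- Cocycles of degree `k` in the subcomplex labelled by `S`. -/
noncomputable def cocycles {V : Type*} [LinearOrder V] [Fintype V] (G : SimpleGraph V)
    [DecidableRel G.Adj] (S : Set V) (k : ℕ) : Submodule ℝ (CE G) :=
  cochains G S k ⊓ LinearMap.ker (Q G)

/-- Coboundaries of degree `k` in the subcomplex labelled by `S`. -/
noncomputable def coboundaries {V : Type*} [LinearOrder V] [Fintype V] (G : SimpleGraph V)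
    [DecidableRel G.Adj] (S : Set V) : ℕ → Submodule ℝ (CE G)
  | 0 => ⊥
  | k + 1 => (cochains G S k).map (Q G)

/-- The cohomology in degree `k` of the subcomplex labelled by `S`. Coboundaries are cocycles, by
`coboundaries_le_cocycles`. -/
abbrev cohomology {V : Type*} [LinearOrder V] [Fintype V] (G : SimpleGraph V)
    [DecidableRel G.Adj] (S : Set V) (k : ℕ) : Type _ :=
  cocycles G S k ⧸ (coboundaries G S k).submoduleOf (cocycles G S k)

/-- The essential cohomology of `G` in degree `k`: the cohomology of the subcomplex labelled by
the whole vertex set. -/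
abbrev essentialCohomology {V : Type*} [LinearOrder V] [Fintype V] (G : SimpleGraph V)
    [DecidableRel G.Adj] (k : ℕ) : Type _ :=
  cohomology G Set.univ k

/-- The dimension `β_k(G)` of the essential cohomology of `G` in degree `k`
(a finite-dimensional space, by the instance below). -/
noncomputable def essentialBetti {V : Type*} [LinearOrder V] [Fintype V] (G : SimpleGraph V)
    [DecidableRel G.Adj] (k : ℕ) : ℕ :=
  Module.finrank ℝ (essentialCohomology G k)

/-- The binomial coefficient with integer entries, with the convention that it is zero
unless `0 ≤ b ≤ a`. -/
def intChoose (a b : ℤ) : ℕ :=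
  if 0 ≤ b ∧ b ≤ a then a.toNat.choose b.toNat else 0

/-- The star graph `S_n` with `n + 1` vertices and `n` edges; the centre is the first vertex. -/
abbrev starGraph (n : ℕ) : SimpleGraph (Fin (n + 1)) := SimpleGraph.starGraph 0

section Facts

theorem x_mul_self {V : Type*} [LinearOrder V] {G : SimpleGraph V} (a : Gen G) :
    x a * x a = 0 :=
  ExteriorAlgebra.ι_sq_zero _

theorem x_mul_comm {V : Type*} [LinearOrder V] {G : SimpleGraph V} (a b : Gen G) :
    x a * x b = -(x b * x a) :=
  eq_neg_of_add_eq_zero_left (ExteriorAlgebra.ι_add_mul_swap _ _)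

theorem partialEdge_one {V : Type*} [LinearOrder V] {G : SimpleGraph V} (e : Edge G) :
    partialEdge e (1 : CE G) = 0 :=
  CliffordAlgebra.contractLeft_one (Q := (0 : QuadraticForm ℝ (DualSpace G))) _

open Classical in
theorem partialEdge_x_mul {V : Type*} [LinearOrder V] {G : SimpleGraph V} (e : Edge G)
    (a : Gen G) (ω : CE G) :
    partialEdge e (x a * ω) = (if a = Sum.inr e then (1 : ℝ) else 0) • ω - x a * partialEdge e ω := by
  have h := CliffordAlgebra.contractLeft_ι_mul (Q := (0 : QuadraticForm ℝ (DualSpace G)))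
    (d := Finsupp.lapply (Sum.inr e)) (Finsupp.single a (1 : ℝ)) ω
  rw [Finsupp.lapply_apply, Finsupp.single_apply] at h
  exact h

theorem Q_one {V : Type*} [LinearOrder V] [Fintype V] (G : SimpleGraph V)
    [DecidableRel G.Adj] : Q G 1 = 0 := by
  have h : ∀ e : Edge G, partialEdge e (1 : CE G) = 0 := partialEdge_one
  simp [Q, h]

theorem Q_vertex {V : Type*} [LinearOrder V] [Fintype V] (G : SimpleGraph V)
    [DecidableRel G.Adj] (i : V) : Q G (x (Sum.inl i)) = 0 := by
  have h : ∀ e : Edge G, partialEdge e (x (Sum.inl i)) = 0 := fun e => by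
    have h1 : partialEdge e (1 : CE G) = 0 := partialEdge_one _
    have := partialEdge_x_mul e (Sum.inl i) 1
    simpa [h1] using this
  simp [Q, h]

theorem Q_edge {V : Type*} [LinearOrder V] [Fintype V] (G : SimpleGraph V)
    [DecidableRel G.Adj] (e : Edge G) :
    Q G (x (Sum.inr e)) = x (Sum.inl e.1.1) * x (Sum.inl e.1.2) := by
  classical
  have h : ∀ f : Edge G, partialEdge f (x (Sum.inr e)) =
      (if e = f then (1 : ℝ) else 0) • (1 : CE G) := fun f => by
    have h1 : partialEdge f (1 : CE G) = 0 := partialEdge_one _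
    have := partialEdge_x_mul f (Sum.inr e) 1
    simpa [h1, Sum.inr.injEq] using this
  simp only [Q, LinearMap.sum_apply, LinearMap.comp_apply, h]
  rw [Finset.sum_eq_single e]
  · simp
  · intro b _ hb
    simp [Ne.symm hb]
  · simp

/-- The graded Leibniz rule, for multiplication by a generator. -/
theorem Q_x_mul {V : Type*} [LinearOrder V] [Fintype V] (G : SimpleGraph V)
    [DecidableRel G.Adj] (a : Gen G) (ω : CE G) :
    Q G (x a * ω) = Q G (x a) * ω - x a * Q G ω := by
  classical
  have h : ∀ f : Edge G, partialEdge f (x a) =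
      (if a = Sum.inr f then (1 : ℝ) else 0) • (1 : CE G) := fun f => by
    have h1 : partialEdge f (1 : CE G) = 0 := partialEdge_one _
    have := partialEdge_x_mul f a 1
    simpa [h1] using this
  have hc : ∀ b c : Gen G, ∀ η : CE G, x b * x c * (x a * η) = x a * (x b * x c * η) := by
    intro b c η
    calc x b * x c * (x a * η) = x b * (x c * x a) * η := by simp only [mul_assoc]
      _ = -(x b * x a) * x c * η := by rw [x_mul_comm c a]; simp only [mul_assoc, mul_neg, neg_mul]
      _ = x a * (x b * x c * η) := by rw [x_mul_comm b a]; simp only [mul_assoc, neg_neg]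
  simp only [Q, LinearMap.sum_apply, LinearMap.comp_apply, partialEdge_x_mul, h,
    LinearMap.mulLeft_apply, mul_sub, Finset.sum_sub_distrib, Finset.sum_mul, Finset.mul_sum, hc]
  congr 1
  refine Finset.sum_congr rfl fun e _ => ?_
  simp

/-- `Q` raises the degree by one and preserves the set of vertices of monomials. -/
theorem Q_mem_cochains {V : Type*} [LinearOrder V] [Fintype V] (G : SimpleGraph V)
    [DecidableRel G.Adj] (S : Set V) (k : ℕ) {ω : CE G} (hω : ω ∈ cochains G S k) :
    Q G ω ∈ cochains G S (k + 1) := by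
  have key : ∀ l : List (Gen G), Q G (l.map x).prod ∈ Submodule.span ℝ {ω | ∃ l' : List (Gen G),
      l'.length = l.length + 1 ∧ monomialVertices l' = monomialVertices l ∧
        (l'.map x).prod = ω} := by
    intro l
    induction l with
    | nil => simp [Q_one]
    | cons a l ih =>
      rw [List.map_cons, List.prod_cons, Q_x_mul]
      refine Submodule.sub_mem _ ?_ ?_
      · rcases a with i | e
        · simp [Q_vertex]
        · rw [Q_edge]
          refine Submodule.subset_span ⟨Sum.inl e.1.1 :: Sum.inl e.1.2 :: l, by simp, ?_, ?_⟩
          · ext v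
            simp [monomialVertices, Gen.vertices, or_assoc]
          · simp [mul_assoc]
      · have h2 := Submodule.mem_map_of_mem (f := LinearMap.mulLeft ℝ (x a)) ih
        rw [Submodule.map_span] at h2
        refine Submodule.span_mono ?_ h2
        rintro _ ⟨_, ⟨l', hl, hv, rfl⟩, rfl⟩
        refine ⟨a :: l', by simp [hl], ?_, by simp⟩
        ext v
        have := Set.ext_iff.1 hv v
        simp only [monomialVertices, Set.mem_ofPred_eq] at this
        simp only [monomialVertices, Set.mem_ofPred_eq, List.mem_cons, or_and_right, exists_or,
          exists_eq_left, this]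
  have h2 := Submodule.mem_map_of_mem (f := Q G) hω
  rw [cochains, Submodule.map_span] at h2
  refine Submodule.span_le.2 ?_ h2
  rintro _ ⟨_, ⟨l, hl, hS, hv, rfl⟩, rfl⟩
  refine Submodule.span_mono ?_ (key l)
  rintro _ ⟨l', hl', hv', rfl⟩
  exact ⟨l', by omega, hS, hv'.trans hv, rfl⟩

theorem Q_Q_x_mul {V : Type*} [LinearOrder V] [Fintype V] (G : SimpleGraph V)
    [DecidableRel G.Adj] (a : Gen G) (ω : CE G) : Q G (Q G (x a * ω)) = x a * Q G (Q G ω) := by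
  rcases a with i | e
  · simp [Q_x_mul, Q_vertex]
  · simp [Q_x_mul, Q_vertex, Q_edge, mul_assoc]

theorem Q_Q_of_mem {V : Type*} [LinearOrder V] [Fintype V] (G : SimpleGraph V)
    [DecidableRel G.Adj] (S : Set V) (k : ℕ) {ω : CE G} (hω : ω ∈ cochains G S k) :
    Q G (Q G ω) = 0 := by
  have key : cochains G S k ≤ LinearMap.ker ((Q G).comp (Q G)) := by
    refine Submodule.span_le.2 ?_
    rintro _ ⟨l, -, -, -, rfl⟩
    change Q G (Q G _) = 0
    induction l with
    | nil => simp [Q_one]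
    | cons a l ih => rw [List.map_cons, List.prod_cons, Q_Q_x_mul, ih, mul_zero]
  exact key hω

theorem coboundaries_le_cocycles {V : Type*} [LinearOrder V] [Fintype V] (G : SimpleGraph V)
    [DecidableRel G.Adj] (S : Set V) (k : ℕ) : coboundaries G S k ≤ cocycles G S k := by
  cases k with
  | zero => exact bot_le
  | succ k =>
    rintro _ ⟨ω, hω, rfl⟩
    exact ⟨Q_mem_cochains G S k hω, Q_Q_of_mem G S k hω⟩

instance finite_cochains {V : Type*} [LinearOrder V] [Fintype V] (G : SimpleGraph V)
    [DecidableRel G.Adj] (S : Set V) (k : ℕ) : Module.Finite ℝ (cochains G S k) := by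
  refine Module.Finite.span_of_finite ℝ
    (((List.finite_length_eq (Gen G) k).image fun l => (l.map x).prod).subset ?_)
  rintro _ ⟨l, hl, -, -, rfl⟩
  exact ⟨l, hl, rfl⟩

instance finite_cocycles {V : Type*} [LinearOrder V] [Fintype V] (G : SimpleGraph V)
    [DecidableRel G.Adj] (S : Set V) (k : ℕ) : Module.Finite ℝ (cocycles G S k) :=
  Submodule.finiteDimensional_of_le (S₂ := cochains G S k) inf_le_left

instance finite_essentialCohomology {V : Type*} [LinearOrder V] [Fintype V] (G : SimpleGraph V)
    [DecidableRel G.Adj] (k : ℕ) : Module.Finite ℝ (essentialCohomology G k) :=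
  inferInstance

end Facts

end DaniMainkar

/-! Write `x_0` for the generator of the centre and `x_i`, `y_i` for those of leaf `i` and of its
edge. Every edge contains the centre, so `Q = x_0 δ`, where `δ = ∑ x_i ∂/∂y_i` is an even derivation
(`lowering`). Let `L_k` be the span of the degree `k` monomials in the `x_i`, `y_i` that involve
every leaf. For `k > n` the cochains of degree `k` are `L_k ⊕ x_0 L_{k-1}`, and `Q (u + x_0 v) = x_0
δ u`. Hence the cocycles are `(L_k ∩ ker δ) ⊕ x_0 L_{k-1}` and the coboundaries are `x_0 δ L_{k-1}`;
by rank-nullity, `β_k` is the sum of the dimensions of `ker δ` on `L_k` and on `L_{k-1}`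
(`essentialBetti_eq`).

A monomial of `L_k` contributes `x_i`, `y_i` or `x_i y_i` at each leaf, so exactly `r = 2n - k`
leaves carry a single generator. The choice of these leaves gives `binom n r`; on them `δ` acts as
the lowering operator of the Boolean lattice of rank `r`, with kernel of dimension `binom r ⌊r/2⌋`.

The count is made by adding one leaf at a time. A new leaf with one generator tensors with a plane,
and as in the Clebsch–Gordan rule the kernel of `δ^(j+1)` then involves those of `δ^(j+2)` and
`δ^j`. So all powers are treated together: `finrank_inf_ker_pow_succ` is the algebraic recurrence,
`centralSum_succ` its numerical counterpart, and `finrank_leafSpan_inf_ker` the result. -/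

namespace DaniMainkar

/-! ### Sums of central binomial coefficients -/

/-- The dimension of the kernel of the `j`-th power of the lowering operator on the Boolean
lattice of rank `r`: the sum of the `j` central binomial coefficients. -/
def centralSum (r : ℤ) (j : ℕ) : ℕ :=
  ∑ t ∈ Finset.range j, intChoose r ((r + 1 - j) / 2 + t)

theorem intChoose_succ (r : ℤ) (hr : 0 ≤ r) (i : ℤ) :
    intChoose (r + 1) i = intChoose r i + intChoose r (i - 1) := by
  lift r to ℕ using hr
  rcases lt_or_ge i 0 with hi | hi
  · simp [intChoose, show ¬ 0 ≤ i by omega, show ¬ 1 ≤ i by omega]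
  lift i to ℕ using hi
  cases i with
  | zero => simp [intChoose, show (0 : ℤ) ≤ r + 1 by omega]
  | succ i =>
    have h : ∀ a b : ℕ, intChoose a b = a.choose b := fun a b => by
      by_cases hab : b ≤ a
      · simp [intChoose, hab]
      · simp [intChoose, hab, Nat.choose_eq_zero_of_lt (not_le.1 hab)]
    have h1 := h (r + 1) (i + 1)
    have h2 := h r (i + 1)
    have h3 := h r i
    push_cast at h1 h2 ⊢
    rw [h1, h2, add_sub_cancel_right, h3, Nat.choose_succ_succ, add_comm]

theorem intChoose_of_neg (a b : ℤ) (hb : b < 0) : intChoose a b = 0 := by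
  simp [intChoose, not_le.2 hb]

theorem centralSum_zero_right (r : ℤ) : centralSum r 0 = 0 := rfl

theorem centralSum_zero_left (j : ℕ) : centralSum 0 (j + 1) = 1 := by
  have h : ∀ i : ℤ, intChoose 0 i = if i = 0 then 1 else 0 := fun i => by
    by_cases hi : i = 0
    · simp [hi, intChoose]
    · simp only [intChoose, hi, if_false]
      rw [if_neg (by omega)]
  simp only [centralSum, h]
  -- The row of rank `0` has one nonzero entry, at index `0`; this is the offset at which the window
  -- reaches it.
  rw [Finset.sum_eq_single (-((0 + 1 - ((j + 1 : ℕ) : ℤ)) / 2)).toNat]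
  · rw [if_pos (by omega)]
  · intro b _ hb
    rw [if_neg (by omega)]
  · intro hb
    rw [Finset.mem_range] at hb
    omega

theorem centralSum_one (r : ℤ) : centralSum r 1 = intChoose r (r / 2) := by
  simp [centralSum]

/-- By Pascal's rule the window `[s, s+j]` in row `r + 1` becomes the windows `[s, s+j]` and `[s-1,
s+j-1]` in row `r`. Exchanging their last terms regroups them as `[s-1, s+j]` and `[s, s+j-1]`, both
again central. -/
theorem centralSum_succ (r : ℤ) (hr : 0 ≤ r) (j : ℕ) :
    centralSum (r + 1) (j + 1) = centralSum r (j + 2) + centralSum r j := by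
  obtain ⟨s, hs⟩ : ∃ s, s = (r + 1 + 1 - ((j + 1 : ℕ) : ℤ)) / 2 := ⟨_, rfl⟩
  have h1 : (r + 1 - ((j + 2 : ℕ) : ℤ)) / 2 = s - 1 := by omega
  have h2 : (r + 1 - (j : ℤ)) / 2 = s := by omega
  have h3 : s - 1 + ((j + 1 : ℕ) : ℤ) = s + j := by push_cast; ring
  simp only [centralSum, h1, h2, ← hs, intChoose_succ r hr, Finset.sum_add_distrib]
  rw [Finset.sum_range_succ (fun t : ℕ => intChoose r (s - 1 + (t : ℤ))) (j + 1),
    Finset.sum_range_succ (fun t : ℕ => intChoose r (s + (t : ℤ))) j, h3,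
    Finset.sum_congr rfl fun (t : ℕ) _ =>
      show intChoose r (s + (t : ℤ) - 1) = intChoose r (s - 1 + t) by congr 1; ring]
  ring

/-! ### Kernels of powers of an operator after adding one leaf -/

open Module in
/-- The kernel of a power of `δ` on `f U ⊕ g U ⊕ h W`, where `δ` commutes with `f` and `h`,
and `δ g = f + g δ`. -/
theorem finrank_inf_ker_pow_succ {E : Type*} [AddCommGroup E] [Module ℝ E] (δ f g h : Module.End ℝ E)
    (U W X : Submodule ℝ E) [Module.Finite ℝ U] [Module.Finite ℝ W]
    (hU : ∀ u ∈ U, δ u ∈ U) (hW : ∀ w ∈ W, δ w ∈ W)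
    (hX : ∀ z, z ∈ X ↔ ∃ u ∈ U, ∃ v ∈ U, ∃ w ∈ W, f u + g v + h w = z)
    (hinj : ∀ u ∈ U, ∀ v ∈ U, ∀ w ∈ W, f u + g v + h w = 0 → u = 0 ∧ v = 0 ∧ w = 0)
    (hf : ∀ u, δ (f u) = f (δ u)) (hg : ∀ u, δ (g u) = f u + g (δ u))
    (hh : ∀ w, δ (h w) = h (δ w)) (j : ℕ) :
    finrank ℝ ↥(X ⊓ LinearMap.ker (δ ^ (j + 1))) =
      finrank ℝ ↥(U ⊓ LinearMap.ker (δ ^ (j + 2))) + finrank ℝ ↥(U ⊓ LinearMap.ker (δ ^ j)) +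
        finrank ℝ ↥(W ⊓ LinearMap.ker (δ ^ (j + 1))) := by
  have hUp : ∀ i, ∀ u ∈ U, (δ ^ i) u ∈ U := fun i u hu => by
    induction i with
    | zero => simpa
    | succ i ih => rw [pow_succ']; exact hU _ ih
  have hWp : ∀ i, ∀ u ∈ W, (δ ^ i) u ∈ W := fun i u hu => by
    induction i with
    | zero => simpa
    | succ i ih => rw [pow_succ']; exact hW _ ih
  have hpow : ∀ i : ℕ, ∀ u v w, (δ ^ (i + 1)) (f u + g v + h w) =
      f ((δ ^ i) (δ u + (i + 1 : ℝ) • v)) + g ((δ ^ (i + 1)) v) + h ((δ ^ (i + 1)) w) := by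
    intro i u v w
    induction i with
    | zero => simp [hf, hg, hh]; abel
    | succ i ih =>
      rw [pow_succ', Module.End.mul_apply, ih]
      simp only [map_add, map_smul, hf, hg, hh, pow_succ' δ, Module.End.mul_apply]
      push_cast
      have hc : ∀ y, δ ((δ ^ i) y) = (δ ^ i) (δ y) := fun y => by
        rw [← Module.End.mul_apply, ← Module.End.mul_apply, ← pow_succ', pow_succ]
      simp only [hc]
      module
  -- By `hpow`, the kernel is given by `δ^j (δ u + (j+1) v) = 0`, `δ^(j+1) v = 0` and `δ^(j+1) w =
  -- 0`. The substitution `p = u`, `q = v + δ u / (j+1)` decouples the first two into `δ^(j+2) p =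
  -- 0` and `δ^j q = 0`; `ψ` is its inverse.
  have hj : (j + 1 : ℝ) ≠ 0 := by positivity
  let ψ : (↥(U ⊓ LinearMap.ker (δ ^ (j + 2))) × ↥(U ⊓ LinearMap.ker (δ ^ j))) ×
      ↥(W ⊓ LinearMap.ker (δ ^ (j + 1))) →ₗ[ℝ] E :=
    LinearMap.coprod (LinearMap.coprod
      ((f - (j + 1 : ℝ)⁻¹ • g.comp δ).comp (Submodule.subtype _))
      (g.comp (Submodule.subtype _))) (h.comp (Submodule.subtype _))
  have hψ : ∀ p q w, ψ ((p, q), w) =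
      f (p : E) + g ((q : E) - (j + 1 : ℝ)⁻¹ • δ (p : E)) + h (w : E) := fun p q w => by
    simp [ψ]; abel
  have hψinj : Function.Injective ψ := by
    rw [injective_iff_map_eq_zero]
    rintro ⟨⟨⟨p, hp⟩, ⟨q, hq⟩⟩, ⟨w, hw⟩⟩ h0
    rw [hψ] at h0
    obtain ⟨h1, h2, h3⟩ := hinj _ hp.1 _
      (U.sub_mem hq.1 (U.smul_mem _ (hU _ hp.1))) _ hw.1 h0
    subst h1 h3
    simp only [map_zero, smul_zero, sub_zero] at h2
    subst h2
    rfl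
  have hrange : LinearMap.range ψ = X ⊓ LinearMap.ker (δ ^ (j + 1)) := by
    ext z
    constructor
    · rintro ⟨⟨⟨⟨p, hp⟩, ⟨q, hq⟩⟩, ⟨w, hw⟩⟩, rfl⟩
      rw [hψ]
      have hp2 : (δ ^ (j + 1)) (δ p) = 0 := by
        have := (Submodule.mem_inf.1 hp).2
        rwa [LinearMap.mem_ker, pow_succ, Module.End.mul_apply] at this
      have hq2 : (δ ^ j) q = 0 := hq.2
      have hw2 : (δ ^ (j + 1)) w = 0 := hw.2
      refine ⟨(hX _).2 ⟨p, hp.1, _, U.sub_mem hq.1 (U.smul_mem _ (hU _ hp.1)), w, hw.1, rfl⟩, ?_⟩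
      change _ ∈ LinearMap.ker _
      rw [LinearMap.mem_ker, hpow]
      have hq3 : (δ ^ (j + 1)) q = 0 := by
        rw [pow_succ', Module.End.mul_apply, hq2, map_zero]
      simp [smul_sub, hj, hq2, hq3, hw2, hp2]
    · rintro ⟨hz, hz0⟩
      obtain ⟨u, hu, v, hv, w, hw, rfl⟩ := (hX _).1 hz
      change _ ∈ LinearMap.ker _ at hz0
      rw [LinearMap.mem_ker, hpow] at hz0
      obtain ⟨h1, h2, h3⟩ := hinj _
        (hUp _ _ (U.add_mem (hU _ hu) (U.smul_mem _ hv))) _ (hUp _ _ hv) _ (hWp _ _ hw) hz0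
      refine ⟨((⟨u, hu, ?_⟩, ⟨v + (j + 1 : ℝ)⁻¹ • δ u,
        U.add_mem hv (U.smul_mem _ (hU _ hu)), ?_⟩), ⟨w, hw, h3⟩), ?_⟩
      -- Applying `δ` once more to the first equation and removing `δ^(j+1) v = 0` leaves `δ^(j+2) u
      -- = 0`.
      · have h4 : (δ ^ (j + 1)) (δ u + (j + 1 : ℝ) • v) = 0 := by
          rw [pow_succ', Module.End.mul_apply, h1, map_zero]
        change _ ∈ LinearMap.ker _
        rw [LinearMap.mem_ker, pow_succ, Module.End.mul_apply]
        simpa [h2] using h4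
      · change _ ∈ LinearMap.ker _
        rw [LinearMap.mem_ker]
        have : v + (j + 1 : ℝ)⁻¹ • δ u = (j + 1 : ℝ)⁻¹ • (δ u + (j + 1 : ℝ) • v) := by
          rw [smul_add, smul_smul, inv_mul_cancel₀ hj, one_smul, add_comm]
        rw [this, map_smul, h1, smul_zero]
      · rw [hψ]
        simp
  have : ∀ i, Module.Finite ℝ ↥(U ⊓ LinearMap.ker (δ ^ i)) := fun i =>
    Submodule.finiteDimensional_of_le (S₂ := U) inf_le_left
  have : ∀ i, Module.Finite ℝ ↥(W ⊓ LinearMap.ker (δ ^ i)) := fun i =>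
    Submodule.finiteDimensional_of_le (S₂ := W) inf_le_left
  rw [← hrange, LinearMap.finrank_range_of_inj hψinj, Module.finrank_prod, Module.finrank_prod]

/-! ### Reordering monomials and contracting generators -/

section Monomials

variable {V : Type*} [LinearOrder V] {G : SimpleGraph V}

/-- Reordering changes a monomial only by a sign, which a submodule absorbs. -/
theorem prod_mem_of_perm (S : Submodule ℝ (CE G)) {l l' : List (Gen G)} (h : l.Perm l')
    (hm : (l'.map x).prod ∈ S) : (l.map x).prod ∈ S := by
  have key : (l.map x).prod = (l'.map x).prod ∨ (l.map x).prod = -(l'.map x).prod := by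
    clear hm
    induction h with
    | nil => simp
    | cons a _ ih => rcases ih with ih | ih <;> simp [ih]
    | swap a b l =>
      right
      simp only [List.map_cons, List.prod_cons, ← mul_assoc]
      rw [x_mul_comm b a, neg_mul]
    | trans _ _ ih1 ih2 => rcases ih1 with h1 | h1 <;> rcases ih2 with h2 | h2 <;> simp [h1, h2]
  rcases key with h | h <;> rw [h]
  · exact hm
  · exact S.neg_mem hm

/-- Used with the two generators of a leaf, and with `b = c` for the centre. -/
theorem prod_of_subset_pair {b c : Gen G} (l : List (Gen G)) (hl : ∀ a ∈ l, a = b ∨ a = c) :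
    (l.map x).prod = 0 ∨ l = [] ∨
      (l.length = 1 ∧ ((l.map x).prod = x b ∨ (l.map x).prod = x c)) ∨
      (l.length = 2 ∧ ((l.map x).prod = x b * x c ∨ (l.map x).prod = -(x b * x c))) := by
  have hcbc : x c * (x b * x c) = 0 := by
    rw [x_mul_comm b c, mul_neg, ← mul_assoc, x_mul_self, zero_mul, neg_zero]
  have hbbc : x b * (x b * x c) = 0 := by rw [← mul_assoc, x_mul_self, zero_mul]
  induction l with
  | nil => simp
  | cons a l ih =>
    rw [List.map_cons, List.prod_cons]
    rcases ih fun a ha => hl a (List.mem_cons_of_mem _ ha) with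
      h | h | ⟨h1, h | h⟩ | ⟨h1, h | h⟩ <;>
    rcases hl a List.mem_cons_self with ha | ha <;>
    first
    | simp [ha, h, h1, x_mul_self, x_mul_comm c b, hcbc, hbbc]
    | simp [ha, h]

/-- Left contraction with the coordinate functional of a generator. -/
noncomputable def contraction (g : Gen G) : CE G →ₗ[ℝ] CE G :=
  CliffordAlgebra.contractLeft
    (Q := (0 : QuadraticForm ℝ (DualSpace G))) (Finsupp.lapply g)

theorem contraction_x_mul_self (a : Gen G) (ω : CE G) :
    contraction a (x a * ω) = ω - x a * contraction a ω := by
  have h := CliffordAlgebra.contractLeft_ι_mul (Q := (0 : QuadraticForm ℝ (DualSpace G)))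
    (d := Finsupp.lapply a) (Finsupp.single a (1 : ℝ)) ω
  rw [Finsupp.lapply_apply, Finsupp.single_eq_same, one_smul] at h
  exact h

theorem contraction_x_mul {g a : Gen G} (hga : a ≠ g) (ω : CE G) :
    contraction g (x a * ω) = -(x a * contraction g ω) := by
  have h := CliffordAlgebra.contractLeft_ι_mul (Q := (0 : QuadraticForm ℝ (DualSpace G)))
    (d := Finsupp.lapply g) (Finsupp.single a (1 : ℝ)) ω
  rw [Finsupp.lapply_apply, Finsupp.single_eq_of_ne (Ne.symm hga), zero_smul, zero_sub] at h
  exact h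

theorem contraction_prod {g : Gen G} (l : List (Gen G)) (hl : g ∉ l) :
    contraction g (l.map x).prod = 0 := by
  induction l with
  | nil => exact CliffordAlgebra.contractLeft_one (Q := (0 : QuadraticForm ℝ (DualSpace G))) _
  | cons a l ih =>
    rw [List.mem_cons, not_or] at hl
    rw [List.map_cons, List.prod_cons, contraction_x_mul (Ne.symm hl.1), ih hl.2, mul_zero,
      neg_zero]

/-- Multiplication by one generator, a second one, and their product are jointly injective
on elements in which these generators do not occur. -/
theorem eq_zero_of_pair {b c : Gen G} (hbc : b ≠ c) {u v w : CE G}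
    (hub : contraction b u = 0) (huc : contraction c u = 0)
    (hvb : contraction b v = 0) (hvc : contraction c v = 0)
    (hwb : contraction b w = 0) (hwc : contraction c w = 0)
    (h : x b * u + x c * v + x b * (x c * w) = 0) : u = 0 ∧ v = 0 ∧ w = 0 := by
  have h1 := congrArg (contraction b) h
  have h2 := congrArg (contraction c) h
  simp only [map_add, map_zero, contraction_x_mul_self, contraction_x_mul hbc,
    contraction_x_mul hbc.symm, hub, huc, hvb, hvc, hwb, hwc, mul_zero, neg_zero, sub_zero,
    add_zero, zero_add] at h1 h2
  have h3 := congrArg (contraction c) h1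
  simp only [map_add, map_zero, contraction_x_mul_self, huc, hwc, mul_zero, sub_zero,
    zero_add] at h3
  subst h3
  simpa using And.intro h1 h2

end Monomials

/-! ### Monomials of the star graph sorted by leaves -/

variable {n : ℕ}

/-- The leaf to which a generator of the star graph belongs; the centre belongs to itself. -/
def leaf : Gen (starGraph n) → Fin (n + 1)
  | Sum.inl i => i
  | Sum.inr e => e.1.2

/-- The edge from the centre to a leaf. -/
def leafEdge (i : Fin (n + 1)) (hi : i ≠ 0) : Edge (starGraph n) :=
  ⟨(0, i), Fin.pos_iff_ne_zero.2 hi, SimpleGraph.starGraph_center_adj hi.symm⟩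

theorem edge_fst (e : Edge (starGraph n)) : e.1.1 = 0 := by
  obtain ⟨⟨a, b⟩, h1, h2⟩ := e
  rw [SimpleGraph.starGraph_adj] at h2
  rcases h2.2 with h | h
  · exact h
  · simp only at h h1
    subst h
    exact absurd h1 (Fin.not_lt_zero a)

theorem edge_snd_ne_zero (e : Edge (starGraph n)) : e.1.2 ≠ 0 := fun h => by
  have := e.2.1
  rw [h] at this
  exact absurd this (Fin.not_lt_zero _)

theorem leaf_eq_zero_iff (a : Gen (starGraph n)) : leaf a = 0 ↔ a = Sum.inl 0 := by
  rcases a with i | e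
  · simp [leaf]
  · simpa [leaf] using edge_snd_ne_zero e

theorem leaf_eq_iff {i : Fin (n + 1)} (hi : i ≠ 0) (a : Gen (starGraph n)) :
    leaf a = i ↔ a = Sum.inl i ∨ a = Sum.inr (leafEdge i hi) := by
  rcases a with j | e
  · simp [leaf]
  · simp only [leaf, reduceCtorEq, false_or, Sum.inr.injEq]
    refine ⟨fun h => Subtype.ext (Prod.ext (edge_fst e) h), ?_⟩
    rintro rfl
    rfl

/-- The span of the monomials of degree `k` whose generators belong to the leaves in `T`,
each of these leaves occurring. -/
noncomputable def leafSpan (T : Finset (Fin (n + 1))) (k : ℤ) : Submodule ℝ (CE (starGraph n)) :=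
  Submodule.span ℝ {ω | ∃ l : List (Gen (starGraph n)),
    (l.length : ℤ) = k ∧ (l.map leaf).toFinset = T ∧ (l.map x).prod = ω}

theorem prod_mem_leafSpan (l : List (Gen (starGraph n))) :
    (l.map x).prod ∈ leafSpan (l.map leaf).toFinset l.length :=
  Submodule.subset_span ⟨l, rfl, rfl, rfl⟩

instance finite_leafSpan (T : Finset (Fin (n + 1))) (k : ℤ) :
    Module.Finite ℝ (leafSpan T k) := by
  refine Module.Finite.span_of_finite ℝ
    (((List.finite_length_eq (Gen (starGraph n)) k.toNat).image fun l => (l.map x).prod).subset ?_)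
  rintro _ ⟨l, hl, -, rfl⟩
  exact ⟨l, show l.length = _ by omega, rfl⟩

/-- Contractions thus detect the new generators, which makes the decompositions below direct. -/
theorem contraction_leafSpan {T : Finset (Fin (n + 1))} {k : ℤ} {g : Gen (starGraph n)}
    (hg : leaf g ∉ T) {ω : CE (starGraph n)} (hω : ω ∈ leafSpan T k) : contraction g ω = 0 := by
  suffices h : leafSpan T k ≤ LinearMap.ker (contraction g) from h hω
  refine Submodule.span_le.2 ?_
  rintro _ ⟨l, -, rfl, rfl⟩
  refine contraction_prod l fun h => hg ?_
  exact List.mem_toFinset.2 (List.mem_map_of_mem h)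

theorem filter_leaf_perm (i : Fin (n + 1)) (l : List (Gen (starGraph n))) :
    l.Perm (l.filter (fun a => leaf a = i) ++ l.filter (fun a => ¬ leaf a = i)) := by
  simpa using (List.filter_append_perm (fun a => decide (leaf a = i)) l).symm

theorem toFinset_filter_leaf_ne (i : Fin (n + 1)) (l : List (Gen (starGraph n))) :
    ((l.filter fun a => ¬ leaf a = i).map leaf).toFinset = (l.map leaf).toFinset.erase i := by
  ext j
  simp only [List.mem_toFinset, List.mem_map, List.mem_filter, Finset.mem_erase, decide_eq_true_eq]
  constructor
  · rintro ⟨a, ⟨h1, h2⟩, rfl⟩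
    exact ⟨h2, a, h1, rfl⟩
  · rintro ⟨h2, a, h1, rfl⟩
    exact ⟨a, ⟨h1, h2⟩, rfl⟩

/-- After the generators of leaf `i` are moved to the front, a nonzero monomial begins, up to sign,
with the vertex, the edge, or both; what remains has degree `k - 1` or `k - 2`. Directness is left
to `eq_zero_of_pair`. -/
theorem mem_leafSpan_insert {i : Fin (n + 1)} (hi : i ≠ 0) {T : Finset (Fin (n + 1))}
    (hiT : i ∉ T) (k : ℤ) (z : CE (starGraph n)) :
    z ∈ leafSpan (insert i T) k ↔ ∃ u ∈ leafSpan T (k - 1), ∃ v ∈ leafSpan T (k - 1),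
      ∃ w ∈ leafSpan T (k - 2), x (Sum.inl i) * u + x (Sum.inr (leafEdge i hi)) * v +
        x (Sum.inl i) * (x (Sum.inr (leafEdge i hi)) * w) = z := by
  have hb : leaf (Sum.inl i : Gen (starGraph n)) = i := rfl
  have hc : leaf (Sum.inr (leafEdge i hi) : Gen (starGraph n)) = i := rfl
  have hpair := leaf_eq_iff (n := n) hi
  generalize (Sum.inl i : Gen (starGraph n)) = b at *
  generalize (Sum.inr (leafEdge i hi) : Gen (starGraph n)) = c at *
  constructor
  · intro hz
    let Y : Submodule ℝ (CE (starGraph n)) :=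
      (leafSpan T (k - 1)).map (LinearMap.mulLeft ℝ (x b)) ⊔
        (leafSpan T (k - 1)).map (LinearMap.mulLeft ℝ (x c)) ⊔
        (leafSpan T (k - 2)).map (LinearMap.mulLeft ℝ (x b) ∘ₗ LinearMap.mulLeft ℝ (x c))
    have hY1 : ∀ u ∈ leafSpan T (k - 1), x b * u ∈ Y := fun u hu =>
      Submodule.mem_sup_left (Submodule.mem_sup_left ⟨u, hu, rfl⟩)
    have hY2 : ∀ u ∈ leafSpan T (k - 1), x c * u ∈ Y := fun u hu =>
      Submodule.mem_sup_left (Submodule.mem_sup_right ⟨u, hu, rfl⟩)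
    have hY3 : ∀ u ∈ leafSpan T (k - 2), x b * x c * u ∈ Y := fun u hu =>
      Submodule.mem_sup_right ⟨u, hu, (mul_assoc (x b) (x c) u).symm⟩
    have hle : leafSpan (insert i T) k ≤ Y := by
      refine Submodule.span_le.2 ?_
      rintro _ ⟨l, rfl, hlT, rfl⟩
      refine prod_mem_of_perm Y (filter_leaf_perm i l) ?_
      have hlen := (filter_leaf_perm i l).length_eq
      have hT := toFinset_filter_leaf_ne i l
      rw [hlT, Finset.erase_insert hiT] at hT
      have hmem := prod_mem_leafSpan (l.filter fun a => ¬ leaf a = i)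
      rw [hT] at hmem
      have hsub : ∀ a ∈ l.filter (fun a => leaf a = i), a = b ∨ a = c := fun a ha => by
        rw [List.mem_filter, decide_eq_true_eq] at ha
        exact (hpair a).1 ha.2
      have hne : l.filter (fun a => leaf a = i) ≠ [] := fun h => by
        have h1 : i ∈ (l.map leaf).toFinset := hlT ▸ Finset.mem_insert_self i T
        rw [List.mem_toFinset, List.mem_map] at h1
        obtain ⟨a, ha, hai⟩ := h1
        have : a ∈ l.filter (fun a => leaf a = i) := by
          rw [List.mem_filter, decide_eq_true_eq]; exact ⟨ha, hai⟩
        rw [h] at this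
        exact absurd this List.not_mem_nil
      rw [List.length_append] at hlen
      rw [List.map_append, List.prod_append]
      rcases prod_of_subset_pair _ hsub with h | h | ⟨h1, h⟩ | ⟨h1, h⟩
      · rw [h, zero_mul]; exact Y.zero_mem
      · exact absurd h hne
      · have hk : ((l.filter fun a => ¬ leaf a = i).length : ℤ) = l.length - 1 := by omega
        rw [hk] at hmem
        rcases h with h | h <;> rw [h]
        exacts [hY1 _ hmem, hY2 _ hmem]
      · have hk : ((l.filter fun a => ¬ leaf a = i).length : ℤ) = l.length - 2 := by omega
        rw [hk] at hmem
        rcases h with h | h <;> rw [h]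
        exacts [hY3 _ hmem, by rw [neg_mul]; exact Y.neg_mem (hY3 _ hmem)]
    obtain ⟨y, hy, _, ⟨w, hw, rfl⟩, rfl⟩ := Submodule.mem_sup.1 (hle hz)
    obtain ⟨_, ⟨u, hu, rfl⟩, _, ⟨v, hv, rfl⟩, rfl⟩ := Submodule.mem_sup.1 hy
    exact ⟨u, hu, v, hv, w, hw, rfl⟩
  · rintro ⟨u, hu, v, hv, w, hw, rfl⟩
    have key : ∀ l' : List (Gen (starGraph n)), l' ≠ [] → (∀ a ∈ l', leaf a = i) → ∀ u,
        u ∈ leafSpan T (k - l'.length) → (l'.map x).prod * u ∈ leafSpan (insert i T) k := by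
      intro l' hne hl' u hu
      suffices h : leafSpan T (k - l'.length) ≤ (leafSpan (insert i T) k).comap
        (LinearMap.mulLeft ℝ (l'.map x).prod) from h hu
      refine Submodule.span_le.2 ?_
      rintro _ ⟨l, hl, hlT, rfl⟩
      refine Submodule.subset_span ⟨l' ++ l, by simp [hl], ?_, by simp⟩
      rw [List.map_append, List.toFinset_append, hlT, Finset.insert_eq]
      congr 1
      ext j
      simp only [List.mem_toFinset, List.mem_map, Finset.mem_singleton]
      constructor
      · rintro ⟨a, ha, rfl⟩
        exact hl' a ha
      · rintro rfl
        obtain ⟨a, ha⟩ := List.exists_mem_of_ne_nil _ hne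
        exact ⟨a, ha, hl' a ha⟩
    refine Submodule.add_mem _ (Submodule.add_mem _ ?_ ?_) ?_
    · simpa using key [b] (by simp) (by simpa using hb) u (by simpa using hu)
    · simpa using key [c] (by simp) (by simpa using hc) v (by simpa using hv)
    · simpa [mul_assoc] using key [b, c] (by simp) (by simpa using ⟨hb, hc⟩) w (by simpa using hw)

/-! ### The lowering operator and the dimensions of its kernels -/

/-- The even derivation that sends the generator of each edge to the one of its leaf. -/
noncomputable def lowering (n : ℕ) : Module.End ℝ (CE (starGraph n)) :=
  ∑ e : Edge (starGraph n), (LinearMap.mulLeft ℝ (x (Sum.inl e.1.2))).comp (partialEdge e)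

theorem Q_eq (ω : CE (starGraph n)) : Q (starGraph n) ω = x (Sum.inl 0) * lowering n ω := by
  simp only [Q, lowering, LinearMap.sum_apply, LinearMap.comp_apply, LinearMap.mulLeft_apply,
    Finset.mul_sum, mul_assoc, edge_fst]

theorem lowering_one : lowering n 1 = 0 := by
  have h : ∀ e : Edge (starGraph n), partialEdge e (1 : CE (starGraph n)) = 0 := partialEdge_one
  simp [lowering, h]

theorem lowering_vertex_mul (i : Fin (n + 1)) (ω : CE (starGraph n)) :
    lowering n (x (Sum.inl i) * ω) = x (Sum.inl i) * lowering n ω := by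
  simp only [lowering, LinearMap.sum_apply, LinearMap.comp_apply, LinearMap.mulLeft_apply,
    Finset.mul_sum, partialEdge_x_mul, reduceCtorEq, if_false, zero_smul, zero_sub, mul_neg]
  refine Finset.sum_congr rfl fun e _ => ?_
  rw [← mul_assoc, x_mul_comm, neg_mul, neg_neg, mul_assoc]

theorem lowering_edge_mul (e : Edge (starGraph n)) (ω : CE (starGraph n)) :
    lowering n (x (Sum.inr e) * ω) = x (Sum.inl e.1.2) * ω + x (Sum.inr e) * lowering n ω := by
  classical
  simp only [lowering, LinearMap.sum_apply, LinearMap.comp_apply, LinearMap.mulLeft_apply,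
    Finset.mul_sum, partialEdge_x_mul, mul_sub, Finset.sum_sub_distrib]
  rw [sub_eq_add_neg, ← Finset.sum_neg_distrib]
  congr 1
  · rw [Finset.sum_eq_single e]
    · simp
    · intro b _ hb
      simp [Ne.symm hb]
    · simp
  · refine Finset.sum_congr rfl fun f _ => ?_
    rw [← mul_assoc, x_mul_comm, neg_mul, neg_neg, mul_assoc]

theorem leafSpan_empty (k : ℤ) :
    leafSpan (n := n) ∅ k = if k = 0 then Submodule.span ℝ {1} else ⊥ := by
  have h : {ω : CE (starGraph n) | ∃ l : List (Gen (starGraph n)),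
      (l.length : ℤ) = k ∧ (l.map leaf).toFinset = ∅ ∧ (l.map x).prod = ω} =
      if k = 0 then {1} else ∅ := by
    ext ω
    split_ifs with hk
    · simp only [List.toFinset_eq_empty_iff, List.map_eq_nil_iff, Set.mem_ofPred_eq,
        Set.mem_singleton_iff]
      constructor
      · rintro ⟨l, -, rfl, rfl⟩
        simp
      · rintro rfl
        exact ⟨[], by simp [hk], rfl, by simp⟩
    · simp only [List.toFinset_eq_empty_iff, List.map_eq_nil_iff, Set.mem_ofPred_eq,
        Set.mem_empty_iff_false, iff_false]
      rintro ⟨l, h, rfl, -⟩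
      exact hk (by simpa using h.symm)
  rw [leafSpan, h]
  split_ifs <;> simp

theorem lowering_mem_leafSpan {T : Finset (Fin (n + 1))} (hT : 0 ∉ T) (k : ℤ) :
    ∀ ω ∈ leafSpan T k, lowering n ω ∈ leafSpan T k := by
  induction T using Finset.induction_on generalizing k with
  | empty =>
    intro ω hω
    rw [leafSpan_empty] at hω
    split_ifs at hω with hk
    · obtain ⟨r, rfl⟩ := Submodule.mem_span_singleton.1 hω
      simp [lowering_one]
    · rw [Submodule.mem_bot] at hω
      simp [hω]
  | insert i T hiT ih =>
    have hi : i ≠ 0 := fun h => hT (h ▸ Finset.mem_insert_self i T)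
    have hT' : 0 ∉ T := fun h => hT (Finset.mem_insert_of_mem h)
    intro ω hω
    obtain ⟨u, hu, v, hv, w, hw, rfl⟩ := (mem_leafSpan_insert hi hiT k ω).1 hω
    refine (mem_leafSpan_insert hi hiT k _).2 ⟨lowering n u + v,
      Submodule.add_mem _ (ih hT' _ u hu) hv, _, ih hT' _ v hv, _, ih hT' _ w hw, ?_⟩
    simp only [map_add, lowering_vertex_mul, lowering_edge_mul, mul_add]
    -- On `x_i y_i w` the derivation of `y_i` produces `x_i x_i w = 0`, so leaves carrying both
    -- generators are inert.
    rw [← mul_assoc (x (Sum.inl i)) (x (Sum.inl (leafEdge i hi).1.2)) w]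
    change _ = _ + (x (Sum.inl i) * v + _) + (x (Sum.inl i) * x (Sum.inl i) * w + _)
    rw [x_mul_self, zero_mul, zero_add]
    abel

-- Induction on the leaves. With `r = 2|T| - (k - 1)`, the new leaf takes one generator (two copies
-- of the span of degree `k - 1`, parameter `r`) or both (degree `k - 2`, parameter `r + 1`).
-- Pascal's rule for the first factor matches this split, and `centralSum_succ` handles the part
-- with one generator.
open Module in
theorem finrank_leafSpan_inf_ker {T : Finset (Fin (n + 1))} (hT : 0 ∉ T) (k : ℤ) (j : ℕ) :
    finrank ℝ ↥(leafSpan T k ⊓ LinearMap.ker (lowering n ^ j)) =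
      intChoose T.card (2 * T.card - k) * centralSum (2 * T.card - k) j := by
  have hzero : LinearMap.ker (lowering n ^ 0) = ⊥ := LinearMap.ker_id
  cases j with
  | zero => rw [hzero, inf_bot_eq, finrank_bot, centralSum_zero_right, mul_zero]
  | succ j =>
  induction T using Finset.induction_on generalizing k j with
  | empty =>
    have hle : leafSpan (n := n) ∅ k ≤ LinearMap.ker (lowering n ^ (j + 1)) := by
      rw [leafSpan_empty]
      split_ifs
      · rw [Submodule.span_singleton_le_iff_mem, LinearMap.mem_ker, pow_succ,
          Module.End.mul_apply, lowering_one, map_zero]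
      · exact bot_le
    have hspan := leafSpan_empty (n := n) k
    rw [inf_eq_left.2 hle]
    simp only [Finset.card_empty, Nat.cast_zero, mul_zero, zero_sub]
    split_ifs at hspan with hk
    · rw [hspan, finrank_span_singleton one_ne_zero, hk, neg_zero, centralSum_zero_left]
      rfl
    · rw [hspan, finrank_bot, intChoose, if_neg (by omega), zero_mul]
  | insert i T hiT ih =>
    have hi : i ≠ 0 := fun h => hT (h ▸ Finset.mem_insert_self i T)
    have hT' : 0 ∉ T := fun h => hT (Finset.mem_insert_of_mem h)
    have ih' : ∀ (k : ℤ) (j : ℕ), finrank ℝ ↥(leafSpan T k ⊓ LinearMap.ker (lowering n ^ j)) =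
        intChoose T.card (2 * T.card - k) * centralSum (2 * T.card - k) j := by
      intro k j
      cases j with
      | zero => rw [hzero, inf_bot_eq, finrank_bot, centralSum_zero_right, mul_zero]
      | succ j => exact ih hT' k j
    rw [finrank_inf_ker_pow_succ (lowering n) (LinearMap.mulLeft ℝ (x (Sum.inl i)))
      (LinearMap.mulLeft ℝ (x (Sum.inr (leafEdge i hi))))
      (LinearMap.mulLeft ℝ (x (Sum.inl i)) ∘ₗ LinearMap.mulLeft ℝ (x (Sum.inr (leafEdge i hi))))
      (leafSpan T (k - 1)) (leafSpan T (k - 2)) _ (lowering_mem_leafSpan hT' _)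
      (lowering_mem_leafSpan hT' _) (mem_leafSpan_insert hi hiT k) ?_
      (lowering_vertex_mul i) (lowering_edge_mul _) ?_ j, ih', ih', ih',
      Finset.card_insert_of_notMem hiT]
    · obtain ⟨r, hr⟩ : ∃ r, r = 2 * (T.card : ℤ) - (k - 1) := ⟨_, rfl⟩
      have h1 : 2 * (T.card : ℤ) - (k - 2) = r + 1 := by omega
      have h2 : 2 * ((T.card + 1 : ℕ) : ℤ) - k = r + 1 := by push_cast; omega
      rw [← hr, h1, h2]
      push_cast
      rw [intChoose_succ _ (by positivity), add_sub_cancel_right]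
      -- The recurrence for `centralSum` needs `r ≥ 0`; for negative `r` the first factor vanishes.
      rcases lt_or_ge r 0 with hr0 | hr0
      · rw [intChoose_of_neg _ r hr0]
        ring
      · rw [centralSum_succ r hr0]
        ring
    · intro u hu v hv w hw h0
      have hb : leaf (Sum.inl i : Gen (starGraph n)) ∉ T := hiT
      have hc : leaf (Sum.inr (leafEdge i hi) : Gen (starGraph n)) ∉ T := hiT
      exact eq_zero_of_pair (by simp) (contraction_leafSpan hb hu) (contraction_leafSpan hc hu)
        (contraction_leafSpan hb hv) (contraction_leafSpan hc hv)
        (contraction_leafSpan hb hw) (contraction_leafSpan hc hw) h0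
    · intro w
      simp only [LinearMap.comp_apply, LinearMap.mulLeft_apply, lowering_vertex_mul,
        lowering_edge_mul, mul_add]
      rw [← mul_assoc]
      change x (Sum.inl i) * x (Sum.inl i) * w + _ = _
      rw [x_mul_self, zero_mul, zero_add]

/-! ### Cochains of the star graph split by the centre -/

theorem vertices_eq_leaf_or (a : Gen (starGraph n)) (v : Fin (n + 1)) (hv : v ≠ 0) :
    v ∈ Gen.vertices a ↔ leaf a = v := by
  rcases a with i | e
  · simp [Gen.vertices, leaf, eq_comm]
  · simp [Gen.vertices, leaf, edge_fst, hv, eq_comm]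

theorem erase_zero_toFinset_leaf {l : List (Gen (starGraph n))}
    (hl : monomialVertices l = Set.univ) :
    (l.map leaf).toFinset.erase 0 = Finset.univ.erase 0 := by
  ext v
  simp only [Finset.mem_erase, Finset.mem_univ, and_true, and_iff_left_iff_imp]
  intro hv
  obtain ⟨a, ha, hav⟩ : v ∈ monomialVertices l := hl ▸ Set.mem_univ v
  exact List.mem_toFinset.2 (List.mem_map.2 ⟨a, ha, (vertices_eq_leaf_or a v hv).1 hav⟩)

theorem monomialVertices_eq_univ {l : List (Gen (starGraph n))}
    (hl : Finset.univ.erase 0 ⊆ (l.map leaf).toFinset)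
    (h0 : (0 : Fin (n + 1)) ∈ monomialVertices l) : monomialVertices l = Set.univ := by
  refine Set.eq_univ_of_forall fun v => ?_
  rcases eq_or_ne v 0 with rfl | hv
  · exact h0
  · have h1 := hl (Finset.mem_erase.2 ⟨hv, Finset.mem_univ v⟩)
    rw [List.mem_toFinset, List.mem_map] at h1
    obtain ⟨a, ha, hav⟩ := h1
    exact ⟨a, ha, (vertices_eq_leaf_or a v hv).2 hav⟩

theorem eq_inl_leaf {l : List (Gen (starGraph n))}
    (h0 : (0 : Fin (n + 1)) ∉ monomialVertices l) : ∀ a ∈ l, a = Sum.inl (leaf a) := by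
  rintro (i | e) ha
  · rfl
  · exact absurd ⟨_, ha, Or.inl (edge_fst e).symm⟩ h0

theorem lowering_prod_eq_zero {l : List (Gen (starGraph n))}
    (hl : ∀ a ∈ l, a = Sum.inl (leaf a)) : lowering n (l.map x).prod = 0 := by
  induction l with
  | nil => exact lowering_one
  | cons a l ih =>
    rw [List.map_cons, List.prod_cons, hl a List.mem_cons_self, lowering_vertex_mul,
      ih fun b hb => hl b (List.mem_cons_of_mem _ hb), mul_zero]

/-- A monomial in the leaves alone vanishes if its degree exceeds their number. -/
theorem prod_eq_zero_of_vertices {l : List (Gen (starGraph n))} (hk : n < l.length)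
    (h0 : (0 : Fin (n + 1)) ∉ monomialVertices l) : (l.map x).prod = 0 := by
  have hvert := eq_inl_leaf h0
  have hne : ∀ a ∈ l, leaf a ≠ 0 := fun a ha h => h0 ⟨a, ha, by
    rw [hvert a ha, h]; exact rfl⟩
  have hdup : ¬ (l.map leaf).Nodup := fun hnd => by
    have h1 := List.toFinset_card_of_nodup hnd
    have h2 : (l.map leaf).toFinset ⊆ Finset.univ.erase 0 := fun v hv => by
      rw [List.mem_toFinset, List.mem_map] at hv
      obtain ⟨a, ha, rfl⟩ := hv
      exact Finset.mem_erase.2 ⟨hne a ha, Finset.mem_univ _⟩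
    have h3 := Finset.card_le_card h2
    rw [h1, Finset.card_erase_of_mem (Finset.mem_univ _), Finset.card_fin, List.length_map] at h3
    omega
  have hdup' : ¬ l.Nodup := fun h => hdup (h.map_on fun a ha b hb hab => by
    rw [hvert a ha, hvert b hb, hab])
  obtain ⟨a, ha⟩ := List.exists_duplicate_iff_not_nodup.2 hdup'
  obtain ⟨l', hl'⟩ := (List.duplicate_iff_sublist.1 ha).exists_perm_append
  have : (l.map x).prod ∈ (⊥ : Submodule ℝ (CE (starGraph n))) := by
    refine prod_mem_of_perm ⊥ hl' ?_
    simp [← mul_assoc, x_mul_self]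
  simpa using this

/-- This inclusion holds in every degree, which matters for coboundaries coming from degree `n`. -/
theorem exists_of_mem_cochains (k : ℕ) {z : CE (starGraph n)}
    (hz : z ∈ cochains (starGraph n) Set.univ k) :
    ∃ u ∈ leafSpan (Finset.univ.erase 0) (k : ℤ),
      ∃ v ∈ leafSpan (Finset.univ.erase 0) ((k : ℤ) - 1), u + x (Sum.inl 0) * v = z := by
  let Y : Submodule ℝ (CE (starGraph n)) := leafSpan (Finset.univ.erase 0) (k : ℤ) ⊔
    (leafSpan (Finset.univ.erase 0) ((k : ℤ) - 1)).map (LinearMap.mulLeft ℝ (x (Sum.inl 0)))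
  have hle : cochains (starGraph n) Set.univ k ≤ Y := by
    refine Submodule.span_le.2 ?_
    rintro _ ⟨l, rfl, -, hlv, rfl⟩
    refine prod_mem_of_perm Y (filter_leaf_perm 0 l) ?_
    have hlen := (filter_leaf_perm 0 l).length_eq
    have hT := toFinset_filter_leaf_ne 0 l
    rw [erase_zero_toFinset_leaf hlv] at hT
    have hmem := prod_mem_leafSpan (l.filter fun a => ¬ leaf a = 0)
    rw [hT] at hmem
    have hsub : ∀ a ∈ l.filter (fun a => leaf a = 0), a = Sum.inl 0 ∨ a = Sum.inl 0 :=
      fun a ha => by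
        rw [List.mem_filter, decide_eq_true_eq] at ha
        exact Or.inl ((leaf_eq_zero_iff a).1 ha.2)
    rw [List.length_append] at hlen
    rw [List.map_append, List.prod_append]
    rcases prod_of_subset_pair _ hsub with h | h | ⟨h1, h⟩ | ⟨-, h⟩
    · rw [h, zero_mul]; exact Y.zero_mem
    · rw [h, List.length_nil, zero_add] at hlen
      rw [← hlen] at hmem
      rw [h, List.map_nil, List.prod_nil, one_mul]
      exact Submodule.mem_sup_left hmem
    · have hk : ((l.filter fun a => ¬ leaf a = 0).length : ℤ) = l.length - 1 := by omega
      rw [hk] at hmem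
      rw [or_self] at h
      rw [h]
      exact Submodule.mem_sup_right ⟨_, hmem, rfl⟩
    · rw [x_mul_self, neg_zero, or_self] at h
      rw [h, zero_mul]; exact Y.zero_mem
  obtain ⟨u, hu, _, ⟨v, hv, rfl⟩, rfl⟩ := Submodule.mem_sup.1 (hle hz)
  exact ⟨u, hu, v, hv, rfl⟩

/-- The bound on `k` serves the summand without `x_0`: there a monomial must contain an edge, hence
the centre, or else it repeats a leaf and vanishes. -/
theorem mem_cochains_iff (k : ℕ) (hk : n < k) (z : CE (starGraph n)) :
    z ∈ cochains (starGraph n) Set.univ k ↔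
      ∃ u ∈ leafSpan (Finset.univ.erase 0) (k : ℤ),
        ∃ v ∈ leafSpan (Finset.univ.erase 0) ((k : ℤ) - 1), u + x (Sum.inl 0) * v = z := by
  constructor
  · exact exists_of_mem_cochains k
  · rintro ⟨u, hu, v, hv, rfl⟩
    refine Submodule.add_mem _ ?_ ?_
    · suffices h : leafSpan (Finset.univ.erase 0) (k : ℤ) ≤
        cochains (starGraph n) Set.univ k from h hu
      refine Submodule.span_le.2 ?_
      rintro _ ⟨l, hl, hlT, rfl⟩
      have hl' : l.length = k := by exact_mod_cast hl
      by_cases h0 : (0 : Fin (n + 1)) ∈ monomialVertices l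
      · exact Submodule.subset_span ⟨l, hl', Set.univ_nonempty,
          monomialVertices_eq_univ hlT.ge h0, rfl⟩
      · rw [prod_eq_zero_of_vertices (hl' ▸ hk) h0]
        exact Submodule.zero_mem _
    · suffices h : leafSpan (Finset.univ.erase 0) ((k : ℤ) - 1) ≤
        (cochains (starGraph n) Set.univ k).comap (LinearMap.mulLeft ℝ (x (Sum.inl 0))) from h hv
      refine Submodule.span_le.2 ?_
      rintro _ ⟨l, hl, hlT, rfl⟩
      refine Submodule.subset_span ⟨Sum.inl 0 :: l, ?_, Set.univ_nonempty,
        monomialVertices_eq_univ ?_ ?_, by simp⟩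
      · rw [List.length_cons]; omega
      · rw [List.map_cons, List.toFinset_cons, hlT]
        exact Finset.subset_insert _ _
      · exact ⟨Sum.inl 0, List.mem_cons_self, rfl⟩

theorem leaf_center_notMem :
    leaf (Sum.inl 0 : Gen (starGraph n)) ∉ (Finset.univ.erase 0 : Finset (Fin (n + 1))) := by
  simp [leaf]

theorem center_mul_eq_zero {k : ℤ} {v : CE (starGraph n)}
    (hv : v ∈ leafSpan (Finset.univ.erase 0) k) (h : x (Sum.inl 0) * v = 0) : v = 0 := by
  have h1 := congrArg (contraction (Sum.inl 0)) h
  rwa [contraction_x_mul_self, contraction_leafSpan leaf_center_notMem hv, mul_zero,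
    sub_zero, map_zero] at h1

theorem center_add_eq_zero {k k' : ℤ} {u v : CE (starGraph n)}
    (hu : u ∈ leafSpan (Finset.univ.erase 0) k) (hv : v ∈ leafSpan (Finset.univ.erase 0) k')
    (h : u + x (Sum.inl 0) * v = 0) : u = 0 ∧ v = 0 := by
  have h1 := congrArg (contraction (Sum.inl 0)) h
  rw [map_add, contraction_x_mul_self, contraction_leafSpan leaf_center_notMem hv,
    contraction_leafSpan leaf_center_notMem hu, mul_zero, sub_zero, map_zero,
    zero_add] at h1
  subst h1
  simpa using h

theorem center_mul_center_mul (v : CE (starGraph n)) :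
    x (Sum.inl 0) * (x (Sum.inl 0) * v) = 0 := by
  rw [← mul_assoc, x_mul_self, zero_mul]

theorem Q_center_mul (v : CE (starGraph n)) :
    Q (starGraph n) (x (Sum.inl 0) * v) = 0 := by
  rw [Q_eq, lowering_vertex_mul, center_mul_center_mul]

theorem lowering_mem (k : ℤ) {v : CE (starGraph n)}
    (hv : v ∈ leafSpan (Finset.univ.erase 0) k) :
    lowering n v ∈ leafSpan (Finset.univ.erase 0) k :=
  lowering_mem_leafSpan (Finset.notMem_erase _ _) k v hv

/-! ### Cocycles, coboundaries and the Betti numbers -/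

open Module in
theorem finrank_cocycles (k : ℕ) (hk : n < k) :
    finrank ℝ (cocycles (starGraph n) Set.univ k) =
      finrank ℝ ↥(leafSpan (n := n) (Finset.univ.erase 0) (k : ℤ) ⊓ LinearMap.ker (lowering n)) +
        finrank ℝ (leafSpan (n := n) (Finset.univ.erase 0) ((k : ℤ) - 1)) := by
  let ψ : ↥(leafSpan (n := n) (Finset.univ.erase 0) (k : ℤ) ⊓ LinearMap.ker (lowering n)) ×
      leafSpan (n := n) (Finset.univ.erase 0) ((k : ℤ) - 1) →ₗ[ℝ] CE (starGraph n) :=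
    LinearMap.coprod (Submodule.subtype _)
      ((LinearMap.mulLeft ℝ (x (Sum.inl 0))).comp (Submodule.subtype _))
  have hψ : ∀ u v, ψ (u, v) = (u : CE (starGraph n)) + x (Sum.inl 0) * (v : CE (starGraph n)) := fun u v => rfl
  have hψinj : Function.Injective ψ := by
    rw [injective_iff_map_eq_zero]
    rintro ⟨⟨u, hu⟩, ⟨v, hv⟩⟩ h0
    obtain ⟨h1, h2⟩ := center_add_eq_zero hu.1 hv h0
    subst h1 h2
    rfl
  have hrange : LinearMap.range ψ = cocycles (starGraph n) Set.univ k := by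
    ext z
    constructor
    · rintro ⟨⟨⟨u, hu⟩, ⟨v, hv⟩⟩, rfl⟩
      refine Submodule.mem_inf.2 ⟨(mem_cochains_iff k hk _).2 ⟨u, hu.1, v, hv, rfl⟩, ?_⟩
      rw [LinearMap.mem_ker, hψ, map_add, Q_center_mul, add_zero, Q_eq,
        LinearMap.mem_ker.1 (Submodule.mem_inf.1 hu).2, mul_zero]
    · intro hz
      obtain ⟨h1, h2⟩ := Submodule.mem_inf.1 hz
      obtain ⟨u, hu, v, hv, rfl⟩ := (mem_cochains_iff k hk z).1 h1
      rw [LinearMap.mem_ker, map_add, Q_center_mul, add_zero, Q_eq] at h2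
      exact ⟨(⟨u, hu, center_mul_eq_zero (lowering_mem _ hu) h2⟩, ⟨v, hv⟩), rfl⟩
  have : Module.Finite ℝ
      ↥(leafSpan (n := n) (Finset.univ.erase 0) (k : ℤ) ⊓ LinearMap.ker (lowering n)) :=
    Submodule.finiteDimensional_of_le
      (S₂ := leafSpan (n := n) (Finset.univ.erase 0) (k : ℤ)) inf_le_left
  rw [← hrange, LinearMap.finrank_range_of_inj hψinj, finrank_prod]

/-- In degree `n` the monomial in all leaves is missing from the cochains, but it is closed. -/
theorem map_Q_cochains (k : ℕ) :
    (cochains (starGraph n) Set.univ k).map (Q (starGraph n)) =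
      (leafSpan (n := n) (Finset.univ.erase 0) (k : ℤ)).map
        (LinearMap.mulLeft ℝ (x (Sum.inl 0)) ∘ₗ lowering n) := by
  apply le_antisymm
  · rintro _ ⟨z, hz, rfl⟩
    obtain ⟨u, hu, v, -, rfl⟩ := exists_of_mem_cochains k hz
    refine ⟨u, hu, ?_⟩
    rw [map_add, Q_center_mul, add_zero, Q_eq]
    rfl
  · rw [Submodule.map_le_iff_le_comap]
    refine Submodule.span_le.2 ?_
    rintro _ ⟨l, hl, hlT, rfl⟩
    have hl' : l.length = k := by exact_mod_cast hl
    suffices h : x (Sum.inl 0) * lowering n (l.map x).prod ∈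
      (cochains (starGraph n) Set.univ k).map (Q (starGraph n)) from h
    by_cases h0 : (0 : Fin (n + 1)) ∈ monomialVertices l
    · exact ⟨_, Submodule.subset_span ⟨l, hl', Set.univ_nonempty,
        monomialVertices_eq_univ hlT.ge h0, rfl⟩, Q_eq _⟩
    · rw [lowering_prod_eq_zero (eq_inl_leaf h0), mul_zero]
      exact Submodule.zero_mem _

open Module in
theorem finrank_map_add_finrank_inf_ker {E : Type*} [AddCommGroup E] [Module ℝ E]
    (f : Module.End ℝ E) (U : Submodule ℝ E) [Module.Finite ℝ U] :
    finrank ℝ (U.map f) + finrank ℝ ↥(U ⊓ LinearMap.ker f) = finrank ℝ U := by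
  have hker : LinearMap.ker (f.domRestrict U) = (LinearMap.ker f).comap U.subtype :=
    LinearMap.ker_domRestrict U f
  rw [← LinearMap.finrank_range_add_finrank_ker (f.domRestrict U), LinearMap.range_domRestrict,
    hker, ← Submodule.map_comap_subtype]
  congr 1
  exact (Submodule.equivMapOfInjective _ U.injective_subtype _).symm.finrank_eq

open Module in
theorem essentialBetti_eq (k : ℕ) (hk : n < k) :
    essentialBetti (starGraph n) k =
      finrank ℝ ↥(leafSpan (n := n) (Finset.univ.erase 0) (k : ℤ) ⊓ LinearMap.ker (lowering n)) +
      finrank ℝ ↥(leafSpan (n := n) (Finset.univ.erase 0) ((k : ℤ) - 1) ⊓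
        LinearMap.ker (lowering n)) := by
  -- The coboundaries come from the new `k`, which may equal `n`; `map_Q_cochains` covers this case,
  -- where `mem_cochains_iff` does not apply.
  obtain ⟨k, rfl⟩ : ∃ k', k = k' + 1 := ⟨k - 1, by omega⟩
  have hquot := Submodule.finrank_quotient_add_finrank
    ((coboundaries (starGraph n) Set.univ (k + 1)).submoduleOf
      (cocycles (starGraph n) Set.univ (k + 1)))
  rw [finrank_cocycles (k + 1) hk, (Submodule.submoduleOfEquivOfLe
    (coboundaries_le_cocycles (starGraph n) Set.univ (k + 1))).finrank_eq] at hquot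
  have hker : leafSpan (n := n) (Finset.univ.erase 0) (k : ℤ) ⊓
      LinearMap.ker (LinearMap.mulLeft ℝ (x (Sum.inl 0)) ∘ₗ lowering n) =
      leafSpan (n := n) (Finset.univ.erase 0) (k : ℤ) ⊓ LinearMap.ker (lowering n) := by
    ext z
    simp only [Submodule.mem_inf, LinearMap.mem_ker, LinearMap.comp_apply,
      LinearMap.mulLeft_apply]
    refine and_congr_right fun hz => ⟨center_mul_eq_zero (lowering_mem _ hz), fun h => ?_⟩
    rw [h, mul_zero]
  have hrank := finrank_map_add_finrank_inf_ker
    (LinearMap.mulLeft ℝ (x (Sum.inl 0)) ∘ₗ lowering n)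
    (leafSpan (n := n) (Finset.univ.erase 0) (k : ℤ))
  rw [hker, ← map_Q_cochains k] at hrank
  have hk' : ((k + 1 : ℕ) : ℤ) - 1 = k := by push_cast; ring
  rw [hk'] at hquot ⊢
  change finrank ℝ (essentialCohomology (starGraph n) (k + 1)) = _
  change finrank ℝ (essentialCohomology (starGraph n) (k + 1)) +
    finrank ℝ ((cochains (starGraph n) Set.univ k).map (Q (starGraph n))) = _ at hquot
  -- The dimension of `L_k` in `hquot`, minus the rank of `x_0 δ` on it, is by `hrank` the dimension
  -- of the kernel of `δ`.
  omega

end DaniMainkar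

theorem mainTheorem5 (n k : ℕ) (hn : 0 < n) (hk : n < k) :
    DaniMainkar.essentialBetti (DaniMainkar.starGraph n) k =
      DaniMainkar.intChoose (2 * (n : ℤ) - k) ((2 * (n : ℤ) - k) / 2) *
          DaniMainkar.intChoose n (2 * (n : ℤ) - k) +
        DaniMainkar.intChoose (2 * (n : ℤ) - k + 1) ((2 * (n : ℤ) - k + 1) / 2) *
          DaniMainkar.intChoose n (2 * (n : ℤ) - k + 1) := by
  have h : ∀ k : ℤ, Module.finrank ℝ ↥(DaniMainkar.leafSpan (Finset.univ.erase 0) k ⊓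
      LinearMap.ker (DaniMainkar.lowering n)) = DaniMainkar.intChoose n (2 * n - k) *
        DaniMainkar.intChoose (2 * n - k) ((2 * n - k) / 2) := fun k => by
    have h1 := DaniMainkar.finrank_leafSpan_inf_ker (n := n)
      -- Only the first power of `δ` is needed here, where `centralSum` is a single central binomial
      -- coefficient.
      (Finset.notMem_erase 0 Finset.univ) k 1
    have hcard : (Finset.univ.erase (0 : Fin (n + 1))).card = n := by simp
    rwa [pow_one, DaniMainkar.centralSum_one, hcard] at h1
  rw [DaniMainkar.essentialBetti_eq k hk, h, h, sub_sub_eq_add_sub, add_sub_right_comm,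
    mul_comm (DaniMainkar.intChoose n _), mul_comm (DaniMainkar.intChoose n _)]
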